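/- **Setting.** Let $\mathcal D$ be a probability distribution on $\mathcal X\times\mathcal Y$, let $\ell:\mathcal Z\times\mathcal Y\to[0,1]$ be a loss, let $\mathcal H$ be a non-empty class of predictors $h:\mathcal X\to\mathcal Z$ (with $(x,y)\mapsto\ell(h(x),y)$ measurable for each $h\in\mathcal H$), and let $\mathcal G$ be a finite collection of measurable subsets (groups) of $\mathcal X$ that is hierarchically structured: for any two distinct $g,g'\in\mathcal G$ exactly one of $g\cap g'=\emptyset$, $g\subsetneq g'$, $g'\subsetneq g$ holds. For a sample $S=((x_i,y_i))_{i\le n}$ put $n_g=\#\{i:x_i\in g\}$, $L_S(f\mid g)=\frac1{n_g}\sum_{i:x_i\in g}\ell(f(x_i),y_i)$ and $L_{\mathcal D}(f\mid g)=\mathbb E_{\mathcal D}[\ell(f(x),y)\mid x\in g]$. Let $\hat h^g\in\arg\min_{h\in\mathcal H}L_S(h\mid g)$. **Algorithm MGL-Tree**, with input $S$, $\mathcal G$ and error rates $\epsilon_n(g)\in(0,\infty]$. Arrange $\mathcal G\cup\{\mathcal X\}$ in the tree with root $\mathcal X$ in which the parent of $g\ne\mathcal X$ is the smallest node strictly containing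 $g$. Set $f^{\mathcal X}:=\hat h^{\mathcal X}$. Visit the other nodes $g$ in breadth-first order: if $L_S(f^{\mathrm{parent}(g)}\mid g)-L_S(\hat h^g\mid g)-\epsilon_n(g)\ge 0$, set $f^g:=\hat h^g$, otherwise set $f^g:=f^{\mathrm{parent}(g)}$. Return the decision tree $f$ given by $f(x)=f^{g}(x)$, where $g$ is the deepest node containing $x$. **Theorem.** Let $0<\delta<1$. 1. If $\mathcal H$ is finite, then with probability at least $1-\delta$ over $n$ i.i.d. examples from $\mathcal D$, MGL-Tree run with $$\epsilon_n(g)=18\sqrt{\frac{2\log(|\mathcal G||\mathcal H|)+\log(8/\delta)}{n_g}}$$ ($\epsilon_n(g)=\infty$ if $n_g=0$) returns a predictor $f$ such that $$L_{\mathcal D}(f\mid g)-\inf_{h\in\mathcal H}L_{\mathcal D}(h\mid g)\le 2\epsilon_n(g)\qquad\text{for all } g\in\mathcal G .$$ 2. If $\mathcal H$ (finite or infinite) has VC dimension at most $d\ge1$ and is a measurable class, then the same holds with $$\epsilon_n(g)=18\sqrt{\frac{2d\log(16|\mathcal G|n/\delta)}{n_g}} .$$ In part 2 it is understood that $\hat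 h^g$ exists. "VC dimension at most $d$" means that the family of sets $\{(x,y):\ell(h(x),y)\ge t\}$ with $h\in\mathcal H$, $0<t\le1$, has VC dimension at most $d$; or alternatively, if all $h\in\mathcal H$ take values in $\{z_0,z_1\}\subseteq\mathcal Z$, that the family of sets $h^{-1}(z_1)$ has VC dimension at most $d$. "Measurable class" means that for all $m$ and $e\in\mathbb R^m$ the function $((x_i,y_i))_{i\le m}\mapsto\sup_{h\in\mathcal H}\bigl|\sum_i e_i\,\ell(h(x_i),y_i)\bigr|$ is measurable with respect to the completion of $\mathcal D^m$. -/

import Mathlib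

open MeasureTheory ProbabilityTheory

namespace MGL

noncomputable section

variable {X Y Z W : Type*}

/-! ### Groups and the tree they form -/

/-- A collection of groups is hierarchically structured if for every pair of distinct groups
exactly one of the following holds: they are disjoint, the first is strictly contained in the
second, the second is strictly contained in the first. -/
def Hierarchical (G : Set (Set X)) : Prop :=
  ∀ g ∈ G, ∀ g' ∈ G, g ≠ g' →
    (Disjoint g g' ∧ ¬ g ⊂ g' ∧ ¬ g' ⊂ g) ∨
    (¬ Disjoint g g' ∧ g ⊂ g' ∧ ¬ g' ⊂ g) ∨
    (¬ Disjoint g g' ∧ ¬ g ⊂ g' ∧ g' ⊂ g)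

/-- The nodes of the hierarchical tree: the groups, together with the root, the whole input
space (nothing is added if the whole space already is a group). -/
def nodes (G : Finset (Set X)) : Set (Set X) := insert Set.univ (G : Set (Set X))

/-- The parent of a non-root node `g`: the smallest node strictly containing `g`. (The nodes
strictly containing `g` form a finite chain that starts with the root, so that their intersection
is the smallest of them.) -/
def parent (G : Finset (Set X)) (g : Set X) : Set X := ⋂₀ {p | p ∈ nodes G ∧ g ⊂ p}

/-- The distance of a node from the root: the number of its strict ancestors. -/
def depth (G : Finset (Set X)) (g : Set X) : ℕ := {p | p ∈ nodes G ∧ g ⊂ p}.ncard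

/-- `order` lists every node other than the root exactly once, in breadth-first order, i.e. level
by level (in any order within a level). -/
def IsBreadthFirst (G : Finset (Set X)) (order : List (Set X)) : Prop :=
  order.Nodup ∧ (∀ g, g ∈ order ↔ g ∈ nodes G ∧ g ≠ Set.univ) ∧
    order.Pairwise (fun g g' => depth G g ≤ depth G g')

/-- The deepest node that contains `x`. (The nodes containing `x` form a finite chain.) -/
def deepest (G : Finset (Set X)) (x : X) : Set X := ⋂₀ {g | g ∈ nodes G ∧ x ∈ g}

/-! ### Risks -/

/-- The number `n_g` of examples of the sample `S` whose input lies in `g`. -/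
def groupCount {n : ℕ} (S : Fin n → X × Y) (g : Set X) : ℕ := {i | (S i).1 ∈ g}.ncard

/-- The group-conditional empirical risk `L_S(f | g)`. -/
def empRisk (ℓ : Z → Y → ℝ) {n : ℕ} (S : Fin n → X × Y) (f : X → Z) (g : Set X) : ℝ :=
  (1 / (groupCount S g : ℝ)) * ∑ i, {i | (S i).1 ∈ g}.indicator (fun i => ℓ (f (S i).1) (S i).2) i

/-- The group-conditional risk `L_D(f | g)`, the expected loss under `D` conditioned on the event
that the input lies in `g`. -/
def risk [MeasurableSpace X] [MeasurableSpace Y] (ℓ : Z → Y → ℝ) (D : Measure (X × Y))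
    (f : X → Z) (g : Set X) : ℝ :=
  ∫ p, ℓ (f p.1) p.2 ∂(ProbabilityTheory.cond D (Prod.fst ⁻¹' g))

/-- `erm` assigns to every node `g` a minimizer over `H` of `L_S(· | g)`. -/
def IsERM (ℓ : Z → Y → ℝ) (H : Set (X → Z)) (G : Finset (Set X)) {n : ℕ} (S : Fin n → X × Y)
    (erm : Set X → X → Z) : Prop :=
  ∀ g ∈ nodes G, erm g ∈ H ∧ ∀ h ∈ H, empRisk ℓ S (erm g) g ≤ empRisk ℓ S h g

/-! ### The algorithm -/

open Classical in
/-- One iteration: the node `g` is visited when the working predictors are `w`. The quantity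
`err_g` compares the predictor inherited from the parent with the group ERM; if it is nonnegative
then the working predictor of `g` becomes the group ERM, and otherwise that of the parent.
The error rate may be `⊤`, and then the node always inherits. -/
def visit (ℓ : Z → Y → ℝ) (G : Finset (Set X)) {n : ℕ} (S : Fin n → X × Y) (ε : Set X → EReal)
    (erm : Set X → X → Z) (w : Set X → X → Z) (g : Set X) : Set X → X → Z :=
  Function.update w g
    (if 0 ≤ (empRisk ℓ S (w (parent G g)) g : EReal) - (empRisk ℓ S (erm g) g : EReal) - ε g
      then erm g else w (parent G g))

/-- The working predictors at the end: initially there is only the root's, the ERM of the whole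
space, and then the other nodes are visited in the given order. -/
def workingPredictors (ℓ : Z → Y → ℝ) (G : Finset (Set X)) {n : ℕ} (S : Fin n → X × Y)
    (ε : Set X → EReal) (erm : Set X → X → Z) (order : List (Set X)) : Set X → X → Z :=
  order.foldl (visit ℓ G S ε erm) (fun _ => erm Set.univ)

/-- The decision tree returned by MGL-Tree: on input `x` it predicts with the working predictor of
the deepest node that contains `x`. -/
def mglTree (ℓ : Z → Y → ℝ) (G : Finset (Set X)) {n : ℕ} (S : Fin n → X × Y)
    (ε : Set X → EReal) (erm : Set X → X → Z) (order : List (Set X)) : X → Z :=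
  fun x => workingPredictors ℓ G S ε erm order (deepest G x) x

/-- The error rate `18 √(c / n_g)`, infinite for a group without examples. -/
def errRate {n : ℕ} (S : Fin n → X × Y) (c : ℝ) (g : Set X) : EReal :=
  if groupCount S g = 0 then ⊤ else ((18 * Real.sqrt (c / (groupCount S g : ℝ)) : ℝ) : EReal)

/-- With probability at least `1 - δ` over `n` i.i.d. examples from `D`, MGL-Tree with input
`ε_n(g) = 18 √(c / n_g)` returns, for every choice of the empirical risk minimizers and every
breadth-first order, a predictor `f` with `L_D(f | g) - inf_{h ∈ H} L_D(h | g) ≤ 2 ε_n(g)` for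
all groups `g` simultaneously. -/
def MGLTreeGuarantee [MeasurableSpace X] [MeasurableSpace Y] (ℓ : Z → Y → ℝ)
    (D : Measure (X × Y)) (H : Set (X → Z)) (G : Finset (Set X)) (n : ℕ) (δ c : ℝ) : Prop :=
  ∃ E : Set (Fin n → X × Y), MeasurableSet E ∧
    ENNReal.ofReal (1 - δ) ≤ Measure.pi (fun _ : Fin n => D) E ∧
    ∀ S ∈ E, ∀ erm : Set X → X → Z, IsERM ℓ H G S erm →
      ∀ order : List (Set X), IsBreadthFirst G order →
        ∀ g ∈ G,
          ((risk ℓ D (mglTree ℓ G S (errRate S c) erm order) g - ⨅ h : H, risk ℓ D h.1 g : ℝ)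
            : EReal) ≤ 2 * errRate S c g

/-! ### VC dimension and measurable classes -/

/-- The family of sets `C` shatters the finite set `A`. -/
def Shatters (C : Set (Set W)) (A : Finset W) : Prop :=
  ∀ B : Finset W, B ⊆ A → ∃ c ∈ C, (A : Set W) ∩ c = B

/-- The VC dimension of a family of sets. -/
def vcDim (C : Set (Set W)) : ℕ∞ := ⨆ (A : Finset W) (_ : Shatters C A), (A.card : ℕ∞)

/-- The family of the sets `{(x, y) | ℓ (h x) y ≥ t}` for `h ∈ H`. For a loss in `[0, 1]`
only `0 < t ≤ 1` matters: any other `t` gives the whole space or the empty set. -/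
def lossSets (ℓ : Z → Y → ℝ) (H : Set (X → Z)) : Set (Set (X × Y)) :=
  {A | ∃ h ∈ H, ∃ t : ℝ, 0 < t ∧ t ≤ 1 ∧ A = {p | t ≤ ℓ (h p.1) p.2}}

/-- The class `H` has VC dimension at most `d`: either in the sense of the sets
`{ℓ (h x) y ≥ t}`, which makes sense for all decision spaces, or, when the members of `H` take
only two values, in the classical sense of binary classifiers. -/
def VCDimLE (ℓ : Z → Y → ℝ) (H : Set (X → Z)) (d : ℕ) : Prop :=
  vcDim (lossSets ℓ H) ≤ d ∨
    ∃ z₀ z₁ : Z, (∀ h ∈ H, ∀ x, h x = z₀ ∨ h x = z₁) ∧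
      vcDim {A : Set X | ∃ h ∈ H, A = h ⁻¹' {z₁}} ≤ d

/-- `H` is a measurable class for `ℓ` and `D` (in the usual sense of empirical process theory):
the suprema of weighted sums of losses over i.i.d. examples are measurable up to null sets. This
holds for instance if `H` is countable and its losses are measurable. -/
def MeasurableClass [MeasurableSpace X] [MeasurableSpace Y] (ℓ : Z → Y → ℝ)
    (D : Measure (X × Y)) (H : Set (X → Z)) : Prop :=
  ∀ (m : ℕ) (e : Fin m → ℝ),
    AEMeasurable (fun s : Fin m → X × Y => ⨆ h : H, |∑ i, e i * ℓ (h.1 (s i).1) (s i).2|)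
      (Measure.pi fun _ : Fin m => D)

end

end MGL

/-!
The theorem splits into a deterministic statement about the tree and a uniform deviation bound.

**The tree.** Call a sample good if, on every group `g` with examples, the empirical and the true
risk of every member of the class differ by at most half the error rate. On a good sample a node
replaces the predictor of its parent only if this does not increase the true risk on the node.
The nodes containing a given point form a chain, along which the loss of the returned predictor
telescopes (`Hierarchical.apply_deepest`); integrating over `g`, the returned predictor is at least
as good on `g` as the working predictor of `g` (`risk_deepest_le`). The latter is, empirically,
within one error rate of the empirical risk minimizer, and passing between empirical and true risks
costs one more (`risk_mglTree_le`).

**The deviations.** Given which examples fall into `g`, these are i.i.d. from the conditional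
distribution (`measure_subsample_le`), so that samples of a fixed size `k` suffice. There a ghost
sample and random exchanges of the two samples reduce the deviations to Rademacher sums
(`measure_exists_lt_abs_sum_sub_integral_le`). These are linear in the loss vectors on the double
sample, so that it is enough to control them on a finite set of vectors that dominates all linear
functionals (`IsLinearCover`). A finite class is its own cover. For a class of VC dimension at most
`d`, the Sauer–Shelah lemma gives a cover with at most `(2 k + 1) ^ d` members; for real-valued
losses it consists of the indicators of superlevel sets, by the layer-cake formula
(`exists_isLinearCover_of_vcDimLE`). A union bound over the groups concludes; the constant `18` in
the error rate is larger than necessary.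

Measurability of the class is used only to average over the exchanges of the two samples. The bad
event itself is treated through its outer measure.
-/

namespace MGL

/-! ### The tree and the working predictors -/

section Tree

variable {X Y Z : Type*}

theorem nodes_finite (G : Finset (Set X)) : (nodes G).Finite :=
  G.finite_toSet.insert _

theorem univ_mem_nodes (G : Finset (Set X)) : Set.univ ∈ nodes G :=
  Set.mem_insert _ _

theorem mem_nodes {G : Finset (Set X)} {g : Set X} : g ∈ nodes G ↔ g = Set.univ ∨ g ∈ G := by
  simp [nodes]

theorem Hierarchical.subset_or_subset_of_mem {G : Finset (Set X)}
    (hG : Hierarchical (G : Set (Set X))) {p q : Set X} (hp : p ∈ nodes G) (hq : q ∈ nodes G)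
    {x : X} (hxp : x ∈ p) (hxq : x ∈ q) : p ⊆ q ∨ q ⊆ p := by
  rcases mem_nodes.1 hp with rfl | hp
  · exact Or.inr (Set.subset_univ _)
  rcases mem_nodes.1 hq with rfl | hq
  · exact Or.inl (Set.subset_univ _)
  by_cases hpq : p = q
  · exact Or.inl hpq.le
  rcases hG p hp q hq hpq with h | h | h
  · exact (Set.disjoint_left.1 h.1 hxp hxq).elim
  · exact Or.inl h.2.1.subset
  · exact Or.inr h.2.2.subset

/-- The strict ancestors of a group form a chain. The empty group needs no special treatment: in a
hierarchical collection its only strict ancestor is the root. -/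
theorem Hierarchical.subset_or_subset_of_ssubset {G : Finset (Set X)}
    (hG : Hierarchical (G : Set (Set X))) {g p q : Set X} (hg : g ∈ G) (hp : p ∈ nodes G)
    (hq : q ∈ nodes G) (hgp : g ⊂ p) (hgq : g ⊂ q) : p ⊆ q ∨ q ⊆ p := by
  rcases mem_nodes.1 hp with rfl | hp'
  · exact Or.inr (Set.subset_univ _)
  have hne : ¬ Disjoint g p := by
    rcases hG g hg p hp' hgp.ne with h | h | h
    · exact (h.2.1 hgp).elim
    · exact h.1
    · exact h.1
  obtain ⟨x, hxg, hxp⟩ := Set.not_disjoint_iff.1 hne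
  exact hG.subset_or_subset_of_mem hp hq hxp (hgq.subset hxg)

theorem Hierarchical.parent_mem_and_ssubset {G : Finset (Set X)}
    (hG : Hierarchical (G : Set (Set X))) {g : Set X} (hg : g ∈ G) (hgu : g ≠ Set.univ) :
    parent G g ∈ nodes G ∧ g ⊂ parent G g := by
  have hfin : {p | p ∈ nodes G ∧ g ⊂ p}.Finite := (nodes_finite G).subset fun p hp => hp.1
  have hne : {p | p ∈ nodes G ∧ g ⊂ p}.Nonempty :=
    ⟨Set.univ, univ_mem_nodes G, Set.ssubset_univ_iff.2 hgu⟩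
  obtain ⟨m, hm⟩ := hfin.exists_minimal hne
  have hle : ∀ p ∈ nodes G, g ⊂ p → m ⊆ p := fun p hp hgp => by
    rcases hG.subset_or_subset_of_ssubset hg hm.1.1 hp hm.1.2 hgp with h | h
    · exact h
    · exact hm.2 ⟨hp, hgp⟩ h
  have hpar : parent G g = m :=
    Set.Subset.antisymm (Set.sInter_subset_of_mem hm.1)
      (Set.subset_sInter fun p hp => hle p hp.1 hp.2)
  rw [hpar]
  exact hm.1

open Classical in
/-- Along the chain of nodes from `g` down to the deepest node containing `x`, the values of any
function on nodes telescope. -/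
theorem Hierarchical.apply_deepest {G : Finset (Set X)} (hG : Hierarchical (G : Set (Set X)))
    (φ : Set X → ℝ) (x : X) {g : Set X} (hg : g ∈ nodes G) (hx : x ∈ g) :
    φ (deepest G x) = φ g +
      ∑ g' ∈ G with g' ⊂ g ∧ x ∈ g', (φ g' - φ (parent G g')) := by
  induction hk : (G.filter fun g' => g' ⊂ g ∧ x ∈ g').card using Nat.strong_induction_on
    generalizing g with
  | _ k ih =>
    subst hk
    rcases (G.filter fun g' => g' ⊂ g ∧ x ∈ g').eq_empty_or_nonempty with h0 | hne
    · have hd : deepest G x = g := by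
        refine Set.Subset.antisymm (Set.sInter_subset_of_mem ⟨hg, hx⟩)
          (Set.subset_sInter fun p hp => ?_)
        rcases hG.subset_or_subset_of_mem hg hp.1 hx hp.2 with h | h
        · exact h
        · by_contra hgp
          have hlt : p ⊂ g := ⟨h, hgp⟩
          rcases mem_nodes.1 hp.1 with rfl | hpG
          · exact hgp (Set.subset_univ _)
          · exact Finset.notMem_empty p (h0 ▸ Finset.mem_filter.2 ⟨hpG, hlt, hp.2⟩)
      rw [h0, hd, Finset.sum_empty, add_zero]
    · -- A maximal node `c` strictly below `g` that contains `x` is a child of `g`.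
      obtain ⟨c, hc⟩ := Finset.exists_maximal hne
      obtain ⟨hcG, hcg, hxc⟩ := Finset.mem_filter.1 hc.1
      have hpar : parent G c = g := by
        refine Set.Subset.antisymm (Set.sInter_subset_of_mem ⟨hg, hcg⟩)
          (Set.subset_sInter fun p hp => ?_)
        rcases hG.subset_or_subset_of_mem hg hp.1 hx (hp.2.subset hxc) with h | h
        · exact h
        · by_contra hgp
          rcases mem_nodes.1 hp.1 with rfl | hpG
          · exact hgp (Set.subset_univ _)
          · exact hp.2.not_subset
              (hc.2 (Finset.mem_filter.2 ⟨hpG, ⟨h, hgp⟩, hp.2.subset hxc⟩) hp.2.subset)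
      have hins : (G.filter fun g' => g' ⊂ g ∧ x ∈ g') =
          insert c (G.filter fun g' => g' ⊂ c ∧ x ∈ g') := by
        ext q
        simp only [Finset.mem_filter, Finset.mem_insert]
        constructor
        · rintro ⟨hqG, hqg, hxq⟩
          by_cases hqc : q = c
          · exact Or.inl hqc
          · refine Or.inr ⟨hqG, ?_, hxq⟩
            rcases hG.subset_or_subset_of_mem (mem_nodes.2 (Or.inr hqG))
              (mem_nodes.2 (Or.inr hcG)) hxq hxc with h | h
            · exact h.ssubset_of_ne hqc
            · exact (hqc (Set.Subset.antisymm
                (hc.2 (Finset.mem_filter.2 ⟨hqG, hqg, hxq⟩) h) h)).elim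
        · rintro (rfl | ⟨hqG, hqc, hxq⟩)
          · exact ⟨hcG, hcg, hxc⟩
          · exact ⟨hqG, hqc.trans hcg, hxq⟩
      have hcn : c ∉ G.filter fun g' => g' ⊂ c ∧ x ∈ g' := by simp
      rw [ih _ (by rw [hins, Finset.card_insert_of_notMem hcn]; exact Nat.lt_succ_self _)
        (mem_nodes.2 (Or.inr hcG)) hxc rfl, hins, Finset.sum_insert hcn, hpar]
      ring

theorem Hierarchical.depth_parent_lt {G : Finset (Set X)} (hG : Hierarchical (G : Set (Set X)))
    {g : Set X} (hg : g ∈ G) (hgu : g ≠ Set.univ) : depth G (parent G g) < depth G g := by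
  obtain ⟨hp, hgp⟩ := hG.parent_mem_and_ssubset hg hgu
  refine Set.ncard_lt_ncard ⟨fun p h => ⟨h.1, hgp.trans h.2⟩, fun h => ?_⟩
    ((nodes_finite G).subset fun p h => h.1)
  exact (h ⟨hp, hgp⟩).2.ne rfl

variable {ℓ : Z → Y → ℝ} {G : Finset (Set X)} {n : ℕ} {S : Fin n → X × Y}
  {ε : Set X → EReal} {erm : Set X → X → Z}

theorem foldl_visit_of_notMem {order : List (Set X)} {g : Set X} (hg : g ∉ order)
    (w : Set X → X → Z) : order.foldl (visit ℓ G S ε erm) w g = w g := by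
  induction order generalizing w with
  | nil => rfl
  | cons a l ih =>
    rw [List.mem_cons, not_or] at hg
    rw [List.foldl_cons, ih hg.2, visit, Function.update_of_ne hg.1]

theorem workingPredictors_univ {order : List (Set X)} (ho : IsBreadthFirst G order) :
    workingPredictors ℓ G S ε erm order Set.univ = erm Set.univ :=
  foldl_visit_of_notMem (fun h => ((ho.2.1 _).1 h).2 rfl) _

open Classical in
/-- The final working predictors satisfy the recursion of the algorithm: in breadth-first order
the parent is settled before its children are visited, and each node is visited once. -/
theorem workingPredictors_eq (hG : Hierarchical (G : Set (Set X))) {order : List (Set X)}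
    (ho : IsBreadthFirst G order) {g : Set X} (hg : g ∈ G) (hgu : g ≠ Set.univ) :
    workingPredictors ℓ G S ε erm order g =
      if 0 ≤ (empRisk ℓ S (workingPredictors ℓ G S ε erm order (parent G g)) g : EReal)
        - (empRisk ℓ S (erm g) g : EReal) - ε g
      then erm g else workingPredictors ℓ G S ε erm order (parent G g) := by
  have hgo : g ∈ order := (ho.2.1 g).2 ⟨mem_nodes.2 (Or.inr hg), hgu⟩
  obtain ⟨l₁, l₂, rfl⟩ := List.append_of_mem hgo
  have hdep := hG.depth_parent_lt hg hgu
  have hg2 : g ∉ l₂ := (List.nodup_cons.1 (List.nodup_append.1 ho.1).2.1).1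
  have hp2 : parent G g ∉ l₂ := fun h =>
    ((List.pairwise_cons.1 (List.pairwise_append.1 ho.2.2).2.1).1 _ h).not_gt hdep
  have hpg : parent G g ≠ g := fun h => by rw [h] at hdep; exact lt_irrefl _ hdep
  unfold workingPredictors
  rw [List.foldl_append, List.foldl_cons, foldl_visit_of_notMem hg2, foldl_visit_of_notMem hp2]
  conv_lhs => rw [visit, Function.update_self]
  conv_rhs => rw [visit, Function.update_of_ne hpg]

theorem workingPredictors_mem {H : Set (X → Z)} (herm : IsERM ℓ H G S erm)
    {order : List (Set X)} (ho : IsBreadthFirst G order) (g : Set X) :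
    workingPredictors ℓ G S ε erm order g ∈ H := by
  classical
  have key : ∀ l : List (Set X), (∀ a ∈ l, a ∈ nodes G) → ∀ w : Set X → X → Z,
      (∀ g, w g ∈ H) → ∀ g, l.foldl (visit ℓ G S ε erm) w g ∈ H := by
    intro l
    induction l with
    | nil => intro _ w hw; exact hw
    | cons a l ih =>
      intro hl w hw
      refine ih (fun b hb => hl b (List.mem_cons_of_mem _ hb)) _ fun q => ?_
      rw [visit, Function.update_apply]
      split_ifs
      · exact (herm a (hl a List.mem_cons_self)).1
      · exact hw _
      · exact hw _
  exact key order (fun a ha => ((ho.2.1 a).1 ha).1) _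
    (fun _ => (herm _ (univ_mem_nodes G)).1) g

end Tree

/-! ### Risks on a good sample -/

section Risk

variable {X Y Z : Type*} [MeasurableSpace X] [MeasurableSpace Y] {D : Measure (X × Y)}
  {ℓ : Z → Y → ℝ}

theorem risk_eq (f : X → Z) (g : Set X) :
    risk ℓ D f g =
      (D (Prod.fst ⁻¹' g)).toReal⁻¹ * ∫ p in Prod.fst ⁻¹' g, ℓ (f p.1) p.2 ∂D := by
  rw [risk, ProbabilityTheory.cond, integral_smul_measure, ENNReal.toReal_inv, smul_eq_mul]

theorem setIntegral_le_of_risk_le [IsFiniteMeasure D] {f f' : X → Z} {g : Set X}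
    (h : risk ℓ D f g ≤ risk ℓ D f' g) :
    ∫ p in Prod.fst ⁻¹' g, ℓ (f p.1) p.2 ∂D ≤ ∫ p in Prod.fst ⁻¹' g, ℓ (f' p.1) p.2 ∂D := by
  rcases eq_or_ne (D (Prod.fst ⁻¹' g)) 0 with h0 | h0
  · rw [Measure.restrict_eq_zero.2 h0, integral_zero_measure, integral_zero_measure]
  · rw [risk_eq, risk_eq] at h
    exact le_of_mul_le_mul_left h (inv_pos.2 (ENNReal.toReal_pos h0 (measure_ne_top _ _)))

theorem integrable_loss [IsFiniteMeasure D] (hℓ : ∀ z y, 0 ≤ ℓ z y ∧ ℓ z y ≤ 1) {f : X → Z}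
    (hf : Measurable fun p : X × Y => ℓ (f p.1) p.2) :
    Integrable (fun p : X × Y => ℓ (f p.1) p.2) D :=
  Integrable.of_mem_Icc 0 1 hf.aemeasurable (ae_of_all _ fun _ => hℓ _ _)

/-- Passing from `w g` to the tree predictor replaces, on each group below `g`, the predictor of
its parent by its own. If no such replacement increases the risk on the group where it happens,
then the tree is at least as good on `g` as `w g`. -/
theorem risk_deepest_le [IsFiniteMeasure D] (hℓ : ∀ z y, 0 ≤ ℓ z y ∧ ℓ z y ≤ 1)
    {G : Finset (Set X)} (hG : Hierarchical (G : Set (Set X)))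
    (hGmeas : ∀ g ∈ G, MeasurableSet g) {w : Set X → X → Z}
    (hw : ∀ g, Measurable fun p : X × Y => ℓ (w g p.1) p.2)
    (hmono : ∀ g ∈ G, g ≠ Set.univ → risk ℓ D (w g) g ≤ risk ℓ D (w (parent G g)) g)
    {g : Set X} (hg : g ∈ G) :
    risk ℓ D (fun x => w (deepest G x) x) g ≤ risk ℓ D (w g) g := by
  classical
  set Δ : Set X → X × Y → ℝ := fun q p => ℓ (w q p.1) p.2 - ℓ (w (parent G q) p.1) p.2 with hΔ
  have hint : ∀ q, Integrable (fun p : X × Y => ℓ (w q p.1) p.2) D := fun q =>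
    integrable_loss hℓ (hw q)
  have hΔint : ∀ q, Integrable (Δ q) D := fun q => (hint q).sub (hint _)
  have hm : ∀ q ∈ G, MeasurableSet (Prod.fst ⁻¹' q : Set (X × Y)) := fun q hq =>
    measurable_fst (hGmeas q hq)
  have hpt : Set.EqOn (fun p : X × Y => ℓ (w (deepest G p.1) p.1) p.2)
      (fun p => ℓ (w g p.1) p.2 +
        ∑ q ∈ G with q ⊂ g, (Prod.fst ⁻¹' q : Set (X × Y)).indicator (Δ q) p)
      (Prod.fst ⁻¹' g) := by
    intro p hp
    have := hG.apply_deepest (fun q => ℓ (w q p.1) p.2) p.1 (mem_nodes.2 (Or.inr hg)) hp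
    simp only [this, ← Finset.filter_filter, hΔ]
    rw [Finset.sum_filter (fun q => p.1 ∈ q)]
    simp [Set.indicator_apply]
  have hΔle : ∀ q ∈ G.filter (· ⊂ g),
      ∫ p in Prod.fst ⁻¹' g, (Prod.fst ⁻¹' q : Set (X × Y)).indicator (Δ q) p ∂D ≤ 0 := by
    intro q hq
    obtain ⟨hqG, hqg⟩ := Finset.mem_filter.1 hq
    rw [setIntegral_indicator (hm q hqG), Set.inter_eq_self_of_subset_right
      (Set.preimage_mono hqg.subset), integral_sub (hint q).integrableOn (hint _).integrableOn,
      sub_nonpos]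
    refine setIntegral_le_of_risk_le (hmono q hqG ?_)
    rintro rfl
    exact hqg.not_subset (Set.subset_univ _)
  rw [risk_eq, risk_eq]
  refine mul_le_mul_of_nonneg_left ?_ (inv_nonneg.2 ENNReal.toReal_nonneg)
  rw [setIntegral_congr_fun (hm g hg) hpt, integral_add (hint g).integrableOn
    (integrable_finsetSum _ fun q hq =>
      ((hΔint q).indicator (hm q (Finset.mem_filter.1 hq).1)).integrableOn),
    integral_finsetSum _ fun q hq =>
      ((hΔint q).indicator (hm q (Finset.mem_filter.1 hq).1)).integrableOn]
  linarith [Finset.sum_nonpos hΔle]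

variable {H : Set (X → Z)} {G : Finset (Set X)} {n : ℕ} {S : Fin n → X × Y}

/-- On a sample whose empirical risks are within half an error rate of the true risks, uniformly
over the class and the groups, MGL-Tree has the claimed accuracy. -/
theorem risk_mglTree_le [IsFiniteMeasure D] (hℓ : ∀ z y, 0 ≤ ℓ z y ∧ ℓ z y ≤ 1)
    (hH : H.Nonempty) (hHmeas : ∀ h ∈ H, Measurable fun p : X × Y => ℓ (h p.1) p.2)
    (hG : Hierarchical (G : Set (Set X))) (hGmeas : ∀ g ∈ G, MeasurableSet g) {c : ℝ}
    (hgood : ∀ g ∈ G, groupCount S g ≠ 0 → ∀ h ∈ H,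
      |empRisk ℓ S h g - risk ℓ D h g| ≤ 9 * √(c / (groupCount S g : ℝ)))
    {erm : Set X → X → Z} (herm : IsERM ℓ H G S erm) {order : List (Set X)}
    (ho : IsBreadthFirst G order) {g : Set X} (hg : g ∈ G) :
    ((risk ℓ D (mglTree ℓ G S (errRate S c) erm order) g - ⨅ h : H, risk ℓ D h.1 g : ℝ) : EReal)
      ≤ 2 * errRate S c g := by
  classical
  by_cases hn : groupCount S g = 0
  · rw [errRate, if_pos hn, EReal.mul_top_of_pos (by norm_num)]
    exact le_top
  set w := workingPredictors ℓ G S (errRate S c) erm order with hwdef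
  have hwH : ∀ q, w q ∈ H := workingPredictors_mem herm ho
  have hrec : ∀ q ∈ G, q ≠ Set.univ →
      (w q = erm q ∧ groupCount S q ≠ 0 ∧
        18 * √(c / (groupCount S q : ℝ)) ≤ empRisk ℓ S (w (parent G q)) q - empRisk ℓ S (erm q) q) ∨
      (w q = w (parent G q) ∧ (groupCount S q ≠ 0 →
        empRisk ℓ S (w q) q < empRisk ℓ S (erm q) q + 18 * √(c / (groupCount S q : ℝ)))) := by
    intro q hq hqu
    have h := workingPredictors_eq (ℓ := ℓ) (S := S) (ε := errRate S c) (erm := erm) hG ho hq hqu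
    rw [← hwdef] at h
    by_cases h0 : groupCount S q = 0
    · right
      rw [errRate, if_pos h0, EReal.sub_top, if_neg (by simp)] at h
      exact ⟨h, fun h1 => (h1 h0).elim⟩
    · rw [errRate, if_neg h0] at h
      norm_cast at h
      split_ifs at h with hc
      · left
        exact ⟨h, h0, by linarith⟩
      · right
        refine ⟨h, fun _ => ?_⟩
        rw [h]
        linarith
  have hmono : ∀ q ∈ G, q ≠ Set.univ → risk ℓ D (w q) q ≤ risk ℓ D (w (parent G q)) q := by
    intro q hq hqu
    rcases hrec q hq hqu with ⟨h1, h2, h3⟩ | ⟨h1, -⟩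
    · have ha := abs_le.1 (hgood q hq h2 _ (hwH (parent G q)))
      have hb := abs_le.1 (hgood q hq h2 _ (hwH q))
      rw [h1] at hb ⊢
      linarith [ha.2, hb.1]
    · rw [h1]
  have htree : risk ℓ D (mglTree ℓ G S (errRate S c) erm order) g ≤ risk ℓ D (w g) g :=
    risk_deepest_le hℓ hG hGmeas (fun q => hHmeas _ (hwH q)) hmono hg
  have hemp : empRisk ℓ S (w g) g ≤ empRisk ℓ S (erm g) g + 18 * √(c / (groupCount S g : ℝ)) := by
    by_cases hgu : g = Set.univ
    · rw [hgu, hwdef, workingPredictors_univ ho]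
      have := Real.sqrt_nonneg (c / (groupCount S (Set.univ : Set X) : ℝ))
      linarith
    · rcases hrec g hg hgu with ⟨h1, -, -⟩ | ⟨-, h2⟩
      · rw [h1]
        have := Real.sqrt_nonneg (c / (groupCount S g : ℝ))
        linarith
      · exact (h2 hn).le
  have hfin : risk ℓ D (mglTree ℓ G S (errRate S c) erm order) g
      - 2 * (18 * √(c / (groupCount S g : ℝ))) ≤ ⨅ h : H, risk ℓ D h.1 g := by
    have : Nonempty H := hH.to_subtype
    refine le_ciInf fun h => ?_
    have ha := abs_le.1 (hgood g hg hn _ (hwH g))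
    have hb := abs_le.1 (hgood g hg hn _ h.2)
    have hc := (herm g (mem_nodes.2 (Or.inr hg))).2 _ h.2
    linarith [ha.1, hb.2]
  rw [errRate, if_neg hn]
  have : ((2 : EReal) * ((18 * √(c / (groupCount S g : ℝ)) : ℝ) : EReal)) =
      ((2 * (18 * √(c / (groupCount S g : ℝ))) : ℝ) : EReal) := by
    rw [EReal.coe_mul 2]
    rfl
  rw [this, EReal.coe_le_coe_iff]
  linarith

end Risk

/-! ### Growth of classes of bounded VC dimension -/

section Growth

variable {W : Type*}

/-- **Sauer–Shelah**, for the traces of a family of sets on a finite family of points, which need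
not be distinct. -/
theorem card_traces_le {J : Type*} [Fintype J] {C : Set (Set W)} {d : ℕ} (hC : vcDim C ≤ d)
    (s : J → W) {𝒜 : Finset (Finset J)} (h𝒜 : ∀ t ∈ 𝒜, ∃ c ∈ C, ∀ j, j ∈ t ↔ s j ∈ c) :
    𝒜.card ≤ (Fintype.card J + 1) ^ d := by
  classical
  have hd : 𝒜.vcDim ≤ d := by
    refine Finset.sup_le fun t ht => ?_
    rw [Finset.mem_shatterer] at ht
    have hinj : Set.InjOn s t := by
      intro i hi j hj hij
      obtain ⟨a, ha, hat⟩ := ht (Finset.singleton_subset_iff.2 hi)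
      obtain ⟨c, -, hc⟩ := h𝒜 a ha
      have hia : i ∈ a := (Finset.mem_inter.1 (hat ▸ Finset.mem_singleton_self i)).2
      have hja : j ∈ t ∩ a := Finset.mem_inter.2 ⟨hj, (hc j).2 (hij ▸ (hc i).1 hia)⟩
      rw [hat] at hja
      exact (Finset.mem_singleton.1 hja).symm
    have hsh : Shatters C (t.image s) := by
      intro B hB
      obtain ⟨a, ha, hat⟩ := ht (Finset.filter_subset (fun j => s j ∈ B) t)
      obtain ⟨c, hcC, hc⟩ := h𝒜 a ha
      refine ⟨c, hcC, ?_⟩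
      have hmem : ∀ j ∈ t, (s j ∈ c ↔ s j ∈ B) := fun j hj => by
        have := Finset.ext_iff.1 hat j
        simp only [Finset.mem_inter, Finset.mem_filter, hj, true_and] at this
        rw [← hc j, this]
      ext w
      constructor
      · rintro ⟨hw, hwc⟩
        obtain ⟨j, hj, rfl⟩ := Finset.mem_image.1 hw
        exact (hmem j hj).1 hwc
      · intro hw
        obtain ⟨j, hj, rfl⟩ := Finset.mem_image.1 (hB hw)
        exact ⟨hB hw, (hmem j hj).2 hw⟩
    have hle : ((t.image s).card : ℕ∞) ≤ vcDim C :=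
      le_iSup₂_of_le (f := fun (A : Finset W) (_ : Shatters C A) => (A.card : ℕ∞)) _ hsh le_rfl
    rw [Finset.card_image_of_injOn hinj] at hle
    exact_mod_cast hle.trans hC
  calc 𝒜.card ≤ 𝒜.shatterer.card := Finset.card_le_card_shatterer 𝒜
    _ ≤ ∑ k ∈ Finset.Iic 𝒜.vcDim, (Fintype.card J).choose k :=
      Finset.card_shatterer_le_sum_vcDim
    _ ≤ ∑ k ∈ Finset.Iic d, (Fintype.card J).choose k :=
      Finset.sum_le_sum_of_subset (Finset.Iic_subset_Iic.2 hd)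
    _ ≤ ∑ k ∈ Finset.Iic d, Fintype.card J ^ k * 1 ^ (d - k) * d.choose k := by
      refine Finset.sum_le_sum fun k hk => ?_
      rw [one_pow, mul_one]
      exact (Nat.choose_le_pow _ _).trans
        (Nat.le_mul_of_pos_right _ (Nat.choose_pos (Finset.mem_Iic.1 hk)))
    _ = (Fintype.card J + 1) ^ d := by
      rw [add_pow, Nat.range_succ_eq_Iic]
      simp

/-- By the layer-cake formula, a linear functional of a vector in `[0,1]^J` is an average of its
values on the indicators of the superlevel sets. -/
theorem exists_abs_sum_le_abs_sum_superlevel {J : Type*} [Fintype J] (a e : J → ℝ)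
    (ha : ∀ j, 0 ≤ a j ∧ a j ≤ 1) :
    ∃ t : ℝ, 0 < t ∧ t ≤ 1 ∧
      |∑ j, e j * a j| ≤ |∑ j, e j * {j | t ≤ a j}.indicator 1 j| := by
  have hint : ∀ j, IntegrableOn (fun t : ℝ => e j * (Set.Iic (a j)).indicator 1 t)
      (Set.Ioc 0 1) := fun j =>
    ((integrableOn_const (C := (1 : ℝ)) (by simp)).indicator measurableSet_Iic).const_mul _
  have hlayer : ∑ j, e j * a j =
      ∫ t in Set.Ioc (0 : ℝ) 1, ∑ j, e j * (Set.Iic (a j)).indicator 1 t := by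
    rw [integral_finsetSum _ fun j _ => hint j]
    refine Finset.sum_congr rfl fun j _ => ?_
    rw [integral_const_mul, setIntegral_indicator measurableSet_Iic]
    have : Set.Ioc (0 : ℝ) 1 ∩ Set.Iic (a j) = Set.Ioc 0 (a j) := by
      rw [Set.Ioc_inter_Iic, min_eq_right (ha j).2]
    simp [this, (ha j).1]
  obtain ⟨t, ht, hle⟩ := exists_setAverage_le (μ := volume) (s := Set.Ioc (0 : ℝ) 1)
    (f := fun t => |∑ j, e j * (Set.Iic (a j)).indicator 1 t|) (by simp) (by simp)
    (integrable_finsetSum _ fun j _ => hint j).abs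
  refine ⟨t, ht.1, ht.2, ?_⟩
  rw [setAverage_eq] at hle
  simp only [measureReal_def, Real.volume_Ioc, sub_zero, ENNReal.ofReal_one, ENNReal.toReal_one,
    inv_one, one_smul] at hle
  rw [hlayer]
  exact (abs_integral_le_integral_abs).trans hle

/-- `V` covers the class of vectors `a` in `ℝ^J`: its members lie in `[0,1]^J`, and each linear
functional is at least as large in absolute value on some member of `V` as on any given vector of
the class. (Equivalently the class lies in the absolutely convex hull of `V`.) -/
def IsLinearCover {κ J : Type*} [Fintype J] (a : κ → J → ℝ) (V : Finset (J → ℝ)) : Prop :=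
  (∀ v ∈ V, ∀ j, 0 ≤ v j ∧ v j ≤ 1) ∧
    ∀ k, ∀ e : J → ℝ, ∃ v ∈ V, |∑ j, e j * a k j| ≤ |∑ j, e j * v j|

variable {X Y Z : Type*} {ℓ : Z → Y → ℝ} {H : Set (X → Z)}

theorem exists_isLinearCover_of_finite (hℓ : ∀ z y, 0 ≤ ℓ z y ∧ ℓ z y ≤ 1) (hH : H.Finite)
    {J : Type*} [Fintype J] (s : J → X × Y) :
    ∃ V : Finset (J → ℝ), V.card ≤ H.ncard ∧
      IsLinearCover (fun (h : H) j => ℓ (h.1 (s j).1) (s j).2) V := by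
  classical
  refine ⟨hH.toFinset.image fun h j => ℓ (h (s j).1) (s j).2, ?_, ?_, ?_⟩
  · rw [Set.ncard_eq_toFinset_card H hH]
    exact Finset.card_image_le
  · intro v hv j
    obtain ⟨h, -, rfl⟩ := Finset.mem_image.1 hv
    exact hℓ _ _
  · intro h e
    exact ⟨_, Finset.mem_image_of_mem _ (hH.mem_toFinset.2 h.2), le_rfl⟩

theorem exists_isLinearCover_of_vcDimLE (hℓ : ∀ z y, 0 ≤ ℓ z y ∧ ℓ z y ≤ 1) {d : ℕ}
    (hd : VCDimLE ℓ H d) {J : Type*} [Fintype J] (s : J → X × Y) :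
    ∃ V : Finset (J → ℝ), V.card ≤ (Fintype.card J + 1) ^ d ∧
      IsLinearCover (fun (h : H) j => ℓ (h.1 (s j).1) (s j).2) V := by
  classical
  rcases hd with hd | ⟨z₀, z₁, hz, hd⟩
  · refine ⟨((Finset.univ : Finset (Finset J)).filter fun t => ∃ c ∈ lossSets ℓ H,
      ∀ j, j ∈ t ↔ s j ∈ c).image fun (t : Finset J) => (t : Set J).indicator 1,
      Finset.card_image_le.trans (card_traces_le hd s fun t ht => (Finset.mem_filter.1 ht).2),
      ?_, ?_⟩
    · intro v hv j
      obtain ⟨t, -, rfl⟩ := Finset.mem_image.1 hv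
      by_cases hj : j ∈ t <;> simp [hj]
    · intro h e
      obtain ⟨t, ht0, ht1, hle⟩ := exists_abs_sum_le_abs_sum_superlevel
        (fun j => ℓ (h.1 (s j).1) (s j).2) e fun j => hℓ _ _
      refine ⟨_, Finset.mem_image_of_mem _ (Finset.mem_filter.2
        ⟨Finset.mem_univ (Finset.univ.filter fun j => t ≤ ℓ (h.1 (s j).1) (s j).2), _,
          ⟨h.1, h.2, t, ht0, ht1, rfl⟩, fun j => by simp⟩), ?_⟩
      simpa using hle
  · refine ⟨((Finset.univ : Finset (Finset J)).filter fun t =>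
      ∃ c ∈ {A : Set X | ∃ h ∈ H, A = h ⁻¹' {z₁}}, ∀ j, j ∈ t ↔ (s j).1 ∈ c).image
        fun t j => ℓ (if j ∈ t then z₁ else z₀) (s j).2,
      Finset.card_image_le.trans (card_traces_le hd (fun j => (s j).1)
        fun t ht => (Finset.mem_filter.1 ht).2), ?_, ?_⟩
    · intro v hv j
      obtain ⟨t, -, rfl⟩ := Finset.mem_image.1 hv
      exact hℓ _ _
    · intro h e
      refine ⟨_, Finset.mem_image_of_mem _ (Finset.mem_filter.2
        ⟨Finset.mem_univ (Finset.univ.filter fun j => h.1 (s j).1 = z₁), _,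
          ⟨h.1, h.2, rfl⟩, fun j => by simp⟩), le_of_eq ?_⟩
      congr 1
      refine Finset.sum_congr rfl fun j _ => ?_
      simp only [Finset.mem_filter, Finset.mem_univ, true_and]
      split_ifs with hj
      · rw [hj]
      · rw [(hz h.1 h.2 (s j).1).resolve_right hj]

end Growth

/-! ### Uniform deviations by symmetrization -/

section UniformDeviation

variable {ι W κ : Type*} [Fintype ι] [MeasurableSpace W]

/-- Hoeffding's inequality for Rademacher sums, as a count of sign patterns; one-sided. -/
theorem card_signs_lt_sum_le [DecidableEq ι] (b : ι → ℝ) (hb : ∀ i, |b i| ≤ 1) {t : ℝ}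
    (ht : 0 ≤ t) (hk : 0 < Fintype.card ι) :
    (((Finset.univ : Finset (ι → Bool)).filter
      fun σ => t < ∑ i, (if σ i then (1 : ℝ) else -1) * b i).card : ℝ) ≤
      2 ^ Fintype.card ι * Real.exp (-t ^ 2 / (2 * Fintype.card ι)) := by
  have hk' : (0 : ℝ) < Fintype.card ι := by exact_mod_cast hk
  -- The parameter of the exponential moment that optimizes the bound.
  set u : ℝ := t / Fintype.card ι with hu
  have hu0 : 0 ≤ u := by positivity
  have hmgf : ∑ σ : ι → Bool, Real.exp (u * ∑ i, (if σ i then (1 : ℝ) else -1) * b i) ≤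
      2 ^ Fintype.card ι * Real.exp (u ^ 2 / 2 * Fintype.card ι) := by
    calc ∑ σ : ι → Bool, Real.exp (u * ∑ i, (if σ i then (1 : ℝ) else -1) * b i)
        = ∑ σ : ι → Bool, ∏ i, Real.exp (u * ((if σ i then (1 : ℝ) else -1) * b i)) := by
          simp_rw [Finset.mul_sum, Real.exp_sum]
      _ = ∏ i, ∑ a : Bool, Real.exp (u * ((if a then (1 : ℝ) else -1) * b i)) := by
          rw [Finset.prod_univ_sum, Fintype.piFinset_univ]
      _ ≤ ∏ _i : ι, (2 * Real.exp (u ^ 2 / 2)) := by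
          refine Finset.prod_le_prod (fun i _ => by positivity) fun i _ => ?_
          have h1 : ∑ a : Bool, Real.exp (u * ((if a then (1 : ℝ) else -1) * b i)) =
              2 * Real.cosh (u * b i) := by
            rw [Real.cosh_eq]
            simp
            ring
          rw [h1]
          refine mul_le_mul_of_nonneg_left ((Real.cosh_le_exp_half_sq _).trans
            (Real.exp_le_exp.2 ?_)) (by norm_num)
          have : b i ^ 2 ≤ 1 := (sq_le_one_iff_abs_le_one _).2 (hb i)
          rw [mul_pow]
          have := mul_le_mul_of_nonneg_left this (sq_nonneg u)
          linarith
      _ = 2 ^ Fintype.card ι * Real.exp (u ^ 2 / 2 * Fintype.card ι) := by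
          rw [Finset.prod_const, Finset.card_univ, mul_pow, ← Real.exp_nat_mul, mul_comm (u ^ 2 / 2)]
  have hmarkov : (((Finset.univ : Finset (ι → Bool)).filter
      fun σ => t < ∑ i, (if σ i then (1 : ℝ) else -1) * b i).card : ℝ) * Real.exp (u * t) ≤
      ∑ σ : ι → Bool, Real.exp (u * ∑ i, (if σ i then (1 : ℝ) else -1) * b i) := by
    rw [← nsmul_eq_mul, ← Finset.sum_const]
    refine (Finset.sum_le_sum fun σ hσ => Real.exp_le_exp.2 (mul_le_mul_of_nonneg_left
      (Finset.mem_filter.1 hσ).2.le hu0)).trans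
      (Finset.sum_le_sum_of_subset_of_nonneg (Finset.filter_subset _ _) fun _ _ _ => by positivity)
  rw [← le_div_iff₀ (Real.exp_pos _)] at hmarkov
  refine hmarkov.trans ((div_le_div_of_nonneg_right hmgf (Real.exp_pos _).le).trans (le_of_eq ?_))
  rw [mul_div_assoc, ← Real.exp_sub]
  congr 2
  rw [hu]
  field_simp
  ring

theorem card_signs_lt_abs_sum_le [DecidableEq ι] (b : ι → ℝ) (hb : ∀ i, |b i| ≤ 1) {t : ℝ}
    (ht : 0 ≤ t) (hk : 0 < Fintype.card ι) :
    (((Finset.univ : Finset (ι → Bool)).filter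
      fun σ => t < |∑ i, (if σ i then (1 : ℝ) else -1) * b i|).card : ℝ) ≤
      2 ^ Fintype.card ι * (2 * Real.exp (-t ^ 2 / (2 * Fintype.card ι))) := by
  have h1 := card_signs_lt_sum_le b hb ht hk
  have h2 := card_signs_lt_sum_le (fun i => -b i) (by simpa using hb) ht hk
  have h3 : ((Finset.univ : Finset (ι → Bool)).filter
      fun σ => t < |∑ i, (if σ i then (1 : ℝ) else -1) * b i|).card ≤
      ((Finset.univ : Finset (ι → Bool)).filter
        fun σ => t < ∑ i, (if σ i then (1 : ℝ) else -1) * b i).card +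
      ((Finset.univ : Finset (ι → Bool)).filter
        fun σ => t < ∑ i, (if σ i then (1 : ℝ) else -1) * -b i).card := by
    simp_rw [lt_abs, mul_neg, Finset.sum_neg_distrib, Finset.filter_or]
    exact Finset.card_union_le _ _
  have h4 : (((Finset.univ : Finset (ι → Bool)).filter
      fun σ => t < |∑ i, (if σ i then (1 : ℝ) else -1) * b i|).card : ℝ) ≤ _ :=
    (Nat.cast_le.2 h3).trans (Nat.cast_add _ _).le
  linarith

theorem measurePreserving_comp_equiv {J J' : Type*} [Fintype J] [Fintype J'] (Q : Measure W)
    [SigmaFinite Q] (e : J ≃ J') :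
    MeasurePreserving (fun s : J' → W => s ∘ e) (Measure.pi fun _ => Q)
      (Measure.pi fun _ => Q) := by
  have hm : Measurable (fun s : J' → W => s ∘ e) := by fun_prop
  refine ⟨hm, (Measure.pi_eq fun A hA => ?_).symm⟩
  rw [Measure.map_apply hm (MeasurableSet.univ_pi hA)]
  have : (fun s : J' → W => s ∘ e) ⁻¹' Set.univ.pi A = Set.univ.pi fun j => A (e.symm j) := by
    ext s
    simp only [Set.mem_preimage, Set.mem_univ_pi, Function.comp]
    exact ⟨fun h j => by simpa using h (e.symm j), fun h j => by simpa using h (e j)⟩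
  rw [this, Measure.pi_pi]
  exact Equiv.prod_comp e.symm fun j => Q (A j)

/-- Exchanges the two copies of those indices whose sign is `false`. -/
def signSwap (σ : ι → Bool) : ι ⊕ ι ≃ ι ⊕ ι :=
  Function.Involutive.toPerm
    (Sum.elim (fun i => if σ i then Sum.inl i else Sum.inr i)
      (fun i => if σ i then Sum.inr i else Sum.inl i)) (by
    rintro (i | i) <;> by_cases h : σ i <;> simp [h])

theorem sum_signSwap (σ : ι → Bool) (F : ι ⊕ ι → ℝ) :
    ∑ i, (F (signSwap σ (Sum.inl i)) - F (signSwap σ (Sum.inr i))) =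
      ∑ i, (if σ i then (1 : ℝ) else -1) * (F (Sum.inl i) - F (Sum.inr i)) := by
  refine Finset.sum_congr rfl fun i _ => ?_
  by_cases h : σ i <;> simp [signSwap, Function.Involutive.toPerm, h]

/-- Symmetrization by random exchanges of the two halves of a double sample. The exchanges preserve
the distribution, and for a fixed double sample they produce Rademacher sums, of which only those
belonging to a cover have to be controlled. -/
theorem measure_exists_lt_abs_sum_sub_le [Nonempty κ] (f : κ → W → ℝ)
    (hf : ∀ k w, 0 ≤ f k w ∧ f k w ≤ 1) (Q : Measure W) [IsProbabilityMeasure Q] {N : ℕ}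
    (hcover : ∀ s : ι ⊕ ι → W, ∃ V : Finset (ι ⊕ ι → ℝ), V.card ≤ N ∧
      IsLinearCover (fun k j => f k (s j)) V)
    (hmeas : AEMeasurable (fun s : ι ⊕ ι → W =>
      ⨆ k, |∑ i, (f k (s (Sum.inl i)) - f k (s (Sum.inr i)))|) (Measure.pi fun _ => Q))
    {t : ℝ} (ht : 0 ≤ t) (hk : 0 < Fintype.card ι) :
    (Measure.pi fun _ : ι ⊕ ι => Q)
      {s | ∃ k, t < |∑ i, (f k (s (Sum.inl i)) - f k (s (Sum.inr i)))|} ≤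
      ENNReal.ofReal (N * (2 * Real.exp (-t ^ 2 / (2 * Fintype.card ι)))) := by
  classical
  set μ : Measure (ι ⊕ ι → W) := Measure.pi fun _ => Q with hμ
  set B : Set (ι ⊕ ι → W) := {s | ∃ k, t < |∑ i, (f k (s (Sum.inl i)) - f k (s (Sum.inr i)))|}
    with hB
  set β : ℝ := 2 * Real.exp (-t ^ 2 / (2 * Fintype.card ι)) with hβ
  have hbdd : ∀ s : ι ⊕ ι → W, BddAbove (Set.range fun k =>
      |∑ i, (f k (s (Sum.inl i)) - f k (s (Sum.inr i)))|) := by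
    refine fun s => ⟨∑ _i : ι, (1 : ℝ), ?_⟩
    rintro _ ⟨k, rfl⟩
    refine (Finset.abs_sum_le_sum_abs _ _).trans (Finset.sum_le_sum fun i _ => ?_)
    have h1 := hf k (s (Sum.inl i))
    have h2 := hf k (s (Sum.inr i))
    exact abs_le.2 ⟨by linarith, by linarith⟩
  have hBnull : NullMeasurableSet B μ := by
    have : B = (fun s : ι ⊕ ι → W =>
        ⨆ k, |∑ i, (f k (s (Sum.inl i)) - f k (s (Sum.inr i)))|) ⁻¹' Set.Ioi t := by
      ext s
      exact (lt_ciSup_iff (hbdd s)).symm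
    rw [this]
    exact hmeas.nullMeasurableSet_preimage measurableSet_Ioi
  have hpres : ∀ σ : ι → Bool, MeasurePreserving (fun s : ι ⊕ ι → W => s ∘ signSwap σ) μ μ :=
    fun σ => measurePreserving_comp_equiv Q (signSwap σ)
  have hcount : ∀ s : ι ⊕ ι → W,
      (((Finset.univ : Finset (ι → Bool)).filter fun σ => s ∘ signSwap σ ∈ B).card : ℝ) ≤
        2 ^ Fintype.card ι * (N * β) := by
    intro s
    obtain ⟨V, hVN, hV01, hV⟩ := hcover s
    have hsub : ((Finset.univ : Finset (ι → Bool)).filter fun σ => s ∘ signSwap σ ∈ B) ⊆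
        V.biUnion fun v => Finset.univ.filter fun σ : ι → Bool =>
          t < |∑ i, (if σ i then (1 : ℝ) else -1) * (v (Sum.inl i) - v (Sum.inr i))| := by
      intro σ hσ
      obtain ⟨k, hk⟩ := (Finset.mem_filter.1 hσ).2
      have hk' := sum_signSwap σ fun j => f k (s j)
      simp only [Function.comp_apply] at hk
      rw [hk'] at hk
      have hlin : ∀ a : ι ⊕ ι → ℝ,
          ∑ i, (if σ i then (1 : ℝ) else -1) * (a (Sum.inl i) - a (Sum.inr i)) =
          ∑ j, Sum.elim (fun i => if σ i then (1 : ℝ) else -1)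
            (fun i => -(if σ i then (1 : ℝ) else -1)) j * a j := by
        intro a
        rw [Fintype.sum_sum_type, ← Finset.sum_add_distrib]
        refine Finset.sum_congr rfl fun i _ => ?_
        simp only [Sum.elim_inl, Sum.elim_inr]
        ring
      rw [hlin fun j => f k (s j)] at hk
      obtain ⟨v, hv, hle⟩ := hV k (Sum.elim (fun i => if σ i then (1 : ℝ) else -1)
            (fun i => -(if σ i then (1 : ℝ) else -1)))
      refine Finset.mem_biUnion.2 ⟨v, hv, Finset.mem_filter.2 ⟨Finset.mem_univ _, ?_⟩⟩
      rw [hlin v]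
      exact hk.trans_le hle
    have h1 : (((Finset.univ : Finset (ι → Bool)).filter fun σ => s ∘ signSwap σ ∈ B).card : ℝ) ≤
        ∑ v ∈ V, ((Finset.univ.filter fun σ : ι → Bool =>
          t < |∑ i, (if σ i then (1 : ℝ) else -1) * (v (Sum.inl i) - v (Sum.inr i))|).card : ℝ) := by
      exact_mod_cast (Finset.card_le_card hsub).trans Finset.card_biUnion_le
    have h2 : ∀ v ∈ V, ((Finset.univ.filter fun σ : ι → Bool =>
          t < |∑ i, (if σ i then (1 : ℝ) else -1) * (v (Sum.inl i) - v (Sum.inr i))|).card : ℝ) ≤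
          2 ^ Fintype.card ι * β := fun v hv => by
      refine card_signs_lt_abs_sum_le (fun i => v (Sum.inl i) - v (Sum.inr i)) (fun i => ?_) ht hk
      have h1 := hV01 v hv (Sum.inl i)
      have h2 := hV01 v hv (Sum.inr i)
      exact abs_le.2 ⟨by linarith, by linarith⟩
    refine (h1.trans (Finset.sum_le_sum h2)).trans ?_
    rw [Finset.sum_const, nsmul_eq_mul, mul_left_comm]
    have hVN' : (V.card : ℝ) ≤ N := by exact_mod_cast hVN
    gcongr
  have hsum : (2 ^ Fintype.card ι : ENNReal) * μ B ≤
      (2 ^ Fintype.card ι : ENNReal) * ENNReal.ofReal (N * β) := by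
    calc (2 ^ Fintype.card ι : ENNReal) * μ B
        = ∑ σ : ι → Bool, μ ((fun s : ι ⊕ ι → W => s ∘ signSwap σ) ⁻¹' B) := by
          rw [Finset.sum_congr rfl fun σ _ => (hpres σ).measure_preimage hBnull]
          simp
      _ = ∑ σ : ι → Bool, ∫⁻ s, ((fun s : ι ⊕ ι → W => s ∘ signSwap σ) ⁻¹' B).indicator 1 s ∂μ :=
          Finset.sum_congr rfl fun σ _ =>
            (lintegral_indicator_one₀ (hBnull.preimage (hpres σ).quasiMeasurePreserving)).symm
      _ = ∫⁻ s, ∑ σ : ι → Bool, ((fun s : ι ⊕ ι → W => s ∘ signSwap σ) ⁻¹' B).indicator 1 s ∂μ :=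
          (lintegral_finsetSum' _ fun σ _ => aemeasurable_one.indicator₀
            (hBnull.preimage (hpres σ).quasiMeasurePreserving)).symm
      _ ≤ ∫⁻ _s, ENNReal.ofReal (2 ^ Fintype.card ι * (N * β)) ∂μ := by
          refine lintegral_mono fun s => ?_
          refine le_trans (le_of_eq ?_) (ENNReal.ofReal_le_ofReal (hcount s))
          rw [ENNReal.ofReal_natCast, Finset.card_filter]
          simp [Set.indicator_apply]
      _ = (2 ^ Fintype.card ι : ENNReal) * ENNReal.ofReal (N * β) := by
          rw [lintegral_const, measure_univ, mul_one, ENNReal.ofReal_mul (by positivity),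
            ENNReal.ofReal_pow (by norm_num), ENNReal.ofReal_ofNat]
  exact (ENNReal.mul_le_mul_iff_right (by simp) (by simp)).1 hsum

/-- Chebyshev's inequality for a sum of independent `[0,1]`-valued variables. -/
theorem half_le_measure_abs_sum_sub_le {f : W → ℝ} (hf : ∀ w, 0 ≤ f w ∧ f w ≤ 1)
    (hfm : Measurable f) (Q : Measure W) [IsProbabilityMeasure Q] {r : ℝ} (hr : 0 < r)
    (hrk : 2 * (Fintype.card ι : ℝ) ≤ r ^ 2) :
    2⁻¹ ≤ (Measure.pi fun _ : ι => Q)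
      {s | |∑ i, f (s i) - Fintype.card ι * ∫ w, f w ∂Q| ≤ r / 2} := by
  set P : Measure (ι → W) := Measure.pi fun _ => Q with hP
  have hIcc : ∀ w, f w ∈ Set.Icc 0 1 := hf
  have hL : MemLp f 2 Q :=
    memLp_of_bounded (ae_of_all _ hIcc) hfm.aestronglyMeasurable 2
  set F : (ι → W) → ℝ := ∑ i, fun s => f (s i) with hF
  have hFs : ∀ s, F s = ∑ i, f (s i) := fun s => by simp [hF]
  have hLi : ∀ i : ι, MemLp (fun s : ι → W => f (s i)) 2 P := fun i =>
    hL.comp_measurePreserving (measurePreserving_eval (fun _ => Q) i)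
  have hmean : ∫ s, F s ∂P = Fintype.card ι * ∫ w, f w ∂Q := by
    simp_rw [hFs]
    rw [integral_finsetSum _ fun i _ => (hLi i).integrable (by norm_num)]
    have : ∀ i : ι, ∫ s : ι → W, f (s i) ∂P = ∫ w, f w ∂Q := fun i =>
      integral_comp_eval (μ := fun _ => Q) hfm.aestronglyMeasurable
    simp [this]
  have hvar : variance F P ≤ Fintype.card ι / 4 := by
    rw [hF, hP, variance_sum_pi (X := fun _ => f) fun _ => hL, Finset.sum_const, Finset.card_univ,
      nsmul_eq_mul]
    have := variance_le_sq_of_bounded (ae_of_all Q hIcc) hfm.aemeasurable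
    have h0 : (0 : ℝ) ≤ Fintype.card ι := Nat.cast_nonneg _
    nlinarith
  have hcheb := meas_ge_le_variance_div_sq (μ := P) (X := F) (memLp_finsetSum' _ fun i _ => hLi i)
    (half_pos hr)
  rw [hmean] at hcheb
  have hhalf : variance F P / (r / 2) ^ 2 ≤ 2⁻¹ := by
    rw [div_le_iff₀ (by positivity)]
    linarith
  have hFm : Measurable F := by
    rw [hF]
    fun_prop
  have hcompl : {s | |∑ i, f (s i) - Fintype.card ι * ∫ w, f w ∂Q| ≤ r / 2} ⊇
      {s | r / 2 ≤ |F s - Fintype.card ι * ∫ w, f w ∂Q|}ᶜ := by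
    intro s hs
    rw [Set.mem_compl_iff, Set.mem_ofPred_eq, not_le, hFs] at hs
    exact hs.le
  refine le_trans ?_ (measure_mono hcompl)
  rw [prob_compl_eq_one_sub (measurableSet_le measurable_const (by fun_prop))]
  have h2 : P {s | r / 2 ≤ |F s - Fintype.card ι * ∫ w, f w ∂Q|} ≤ 2⁻¹ := by
    refine (hcheb.trans (ENNReal.ofReal_le_ofReal hhalf)).trans (le_of_eq ?_)
    rw [ENNReal.ofReal_inv_of_pos (by norm_num), ENNReal.ofReal_ofNat]
  calc (2⁻¹ : ENNReal) = 1 - 2⁻¹ := ENNReal.one_sub_inv_two.symm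
    _ ≤ _ := tsub_le_tsub_left h2 1

/-- **Uniform deviations** over a class with small covers, from the symmetrization bound by means
of an independent ghost sample. The set on the left need not be measurable. -/
theorem measure_exists_lt_abs_sum_sub_integral_le [Nonempty κ] (f : κ → W → ℝ)
    (hf : ∀ k w, 0 ≤ f k w ∧ f k w ≤ 1) (hfm : ∀ k, Measurable (f k)) (Q : Measure W)
    [IsProbabilityMeasure Q] {N : ℕ}
    (hcover : ∀ s : ι ⊕ ι → W, ∃ V : Finset (ι ⊕ ι → ℝ), V.card ≤ N ∧
      IsLinearCover (fun k j => f k (s j)) V)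
    (hmeas : AEMeasurable (fun s : ι ⊕ ι → W =>
      ⨆ k, |∑ i, (f k (s (Sum.inl i)) - f k (s (Sum.inr i)))|) (Measure.pi fun _ => Q))
    {r : ℝ} (hr : 0 < r) (hk : 0 < Fintype.card ι) (hrk : 2 * (Fintype.card ι : ℝ) ≤ r ^ 2) :
    (Measure.pi fun _ : ι => Q)
      {s | ∃ k, r < |∑ i, f k (s i) - Fintype.card ι * ∫ w, f k w ∂Q|} ≤
      ENNReal.ofReal (4 * N * Real.exp (-r ^ 2 / (8 * Fintype.card ι))) := by
  set P : Measure (ι → W) := Measure.pi fun _ => Q with hP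
  set μ : Measure (ι ⊕ ι → W) := Measure.pi fun _ => Q with hμ
  set B : Set (ι ⊕ ι → W) :=
    {s | ∃ k, r / 2 < |∑ i, (f k (s (Sum.inl i)) - f k (s (Sum.inr i)))|} with hB
  have hBle := measure_exists_lt_abs_sum_sub_le f hf Q hcover hmeas (half_pos hr).le hk
  rw [← hμ, ← hB] at hBle
  have hpres : MeasurePreserving (MeasurableEquiv.sumPiEquivProdPi fun _ : ι ⊕ ι => W).symm
      (P.prod P) μ := measurePreserving_sumPiEquivProdPi_symm fun _ => Q
  set T : Set ((ι → W) × (ι → W)) :=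
    (MeasurableEquiv.sumPiEquivProdPi fun _ : ι ⊕ ι => W).symm ⁻¹' toMeasurable μ B with hT
  have hTm : MeasurableSet T := hpres.measurable (measurableSet_toMeasurable _ _)
  have hTB : (P.prod P) T = μ B := by
    rw [hT, hpres.measure_preimage (measurableSet_toMeasurable _ _).nullMeasurableSet,
      measure_toMeasurable]
  have hsub : {s | ∃ k, r < |∑ i, f k (s i) - Fintype.card ι * ∫ w, f k w ∂Q|} ⊆
      {s | 2⁻¹ ≤ P (Prod.mk s ⁻¹' T)} := by
    rintro s ⟨k, hk⟩
    refine (half_le_measure_abs_sum_sub_le (hf k) (hfm k) Q hr hrk).trans (measure_mono ?_)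
    intro s' hs'
    refine subset_toMeasurable μ B ⟨k, ?_⟩
    change r / 2 < |∑ i, (f k (s i) - f k (s' i))|
    rw [Finset.sum_sub_distrib]
    have h1 := abs_sub_le (∑ i, f k (s i)) (∑ i, f k (s' i)) (Fintype.card ι * ∫ w, f k w ∂Q)
    have h2 : |∑ i, f k (s' i) - Fintype.card ι * ∫ w, f k w ∂Q| ≤ r / 2 := hs'
    linarith
  calc P {s | ∃ k, r < |∑ i, f k (s i) - Fintype.card ι * ∫ w, f k w ∂Q|}
      ≤ P {s | 2⁻¹ ≤ P (Prod.mk s ⁻¹' T)} := measure_mono hsub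
    _ ≤ (∫⁻ s, P (Prod.mk s ⁻¹' T) ∂P) / 2⁻¹ :=
      meas_ge_le_lintegral_div (measurable_measure_prodMk_left hTm).aemeasurable (by simp) (by simp)
    _ = 2 * μ B := by
      rw [← Measure.prod_apply hTm, hTB, ENNReal.div_eq_inv_mul, inv_inv]
    _ ≤ 2 * ENNReal.ofReal (N * (2 * Real.exp (-(r / 2) ^ 2 / (2 * Fintype.card ι)))) := by gcongr
    _ = ENNReal.ofReal (4 * N * Real.exp (-r ^ 2 / (8 * Fintype.card ι))) := by
      rw [← ENNReal.ofReal_ofNat 2, ← ENNReal.ofReal_mul (by norm_num)]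
      congr 1
      have : -(r / 2) ^ 2 / (2 * (Fintype.card ι : ℝ)) = -r ^ 2 / (8 * Fintype.card ι) := by
        field_simp
        norm_num
      rw [this]
      ring

end UniformDeviation

/-! ### Conditioning on the examples that fall into a set -/

section Conditioning

variable {W : Type*} [MeasurableSpace W]

theorem pi_cond {ι : Type*} [Fintype ι] (D : Measure W) [IsProbabilityMeasure D] {A : Set W}
    (hA0 : D A ≠ 0) :
    Measure.pi (fun _ : ι => cond D A) =
      (D A)⁻¹ ^ Fintype.card ι •
        (Measure.pi fun _ : ι => D).restrict (Set.univ.pi fun _ => A) := by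
  have := cond_isProbabilityMeasure hA0
  refine Measure.pi_eq fun B _ => ?_
  rw [Measure.restrict_pi_pi, Measure.smul_apply, Measure.pi_pi, smul_eq_mul]
  simp only [ProbabilityTheory.cond, Measure.smul_apply, smul_eq_mul]
  rw [Finset.prod_mul_distrib, Finset.prod_const, Finset.card_univ]

theorem pi_cond_absolutelyContinuous {ι : Type*} [Fintype ι] (D : Measure W)
    [IsProbabilityMeasure D] {A : Set W} (hA0 : D A ≠ 0) :
    Measure.pi (fun _ : ι => cond D A) ≪ Measure.pi fun _ : ι => D := by
  rw [pi_cond D hA0]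
  exact Measure.AbsolutelyContinuous.smul_left Measure.restrict_le_self.absolutelyContinuous _

/-- Given which of the examples fall into `A`, these are i.i.d. from the conditional distribution.
Hence a bound for conditional samples of every positive size carries over to the random subsample
of the examples in `A`. -/
theorem measure_subsample_le {n : ℕ} (D : Measure W) [IsProbabilityMeasure D] {A : Set W}
    (hA : MeasurableSet A) (T : ∀ I : Finset (Fin n), Set (I → W)) {β : ENNReal}
    (hT : D A ≠ 0 → ∀ I : Finset (Fin n), I.Nonempty →
      Measure.pi (fun _ : I => cond D A) (T I) ≤ β) :
    Measure.pi (fun _ : Fin n => D) {S | ∃ I : Finset (Fin n), I.Nonempty ∧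
      (∀ i, i ∈ I ↔ S i ∈ A) ∧ (fun i : I => S i) ∈ T I} ≤ β := by
  classical
  set μ : Measure (Fin n → W) := Measure.pi fun _ => D with hμ
  set pat : Finset (Fin n) → Set (Fin n → W) := fun I => {S | ∀ i, i ∈ I ↔ S i ∈ A} with hpat
  have hsplit : ∀ (I : Finset (Fin n)) (U : Set (I → W)),
      μ {S | (∀ i, i ∈ I ↔ S i ∈ A) ∧ (fun i : I => S i) ∈ U} =
        Measure.pi (fun _ : I => D) (U ∩ Set.univ.pi fun _ => A) *
          Measure.pi (fun _ : {i // i ∉ I} => D) (Set.univ.pi fun _ => Aᶜ) := by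
    intro I U
    have hp := measurePreserving_piEquivPiSubtypeProd (fun _ : Fin n => D) (· ∈ I)
    have h := hp.measure_preimage_equiv
      ((U ∩ Set.univ.pi fun _ => A) ×ˢ (Set.univ.pi fun _ => Aᶜ))
    rw [Measure.prod_prod] at h
    refine Eq.trans (congrArg μ ?_) (h.trans (by congr!))
    ext S
    simp only [Set.mem_preimage, Set.mem_prod, Set.mem_inter_iff, Set.mem_univ_pi]
    change _ ↔ ((fun i : I => S i) ∈ U ∧ ∀ i : I, S i ∈ A) ∧ ∀ i : {i // i ∉ I}, S i ∈ Aᶜ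
    constructor
    · rintro ⟨h1, h2⟩
      exact ⟨⟨h2, fun i => (h1 i).1 i.2⟩, fun i hi => i.2 ((h1 i).2 hi)⟩
    · rintro ⟨⟨h1, h2⟩, h3⟩
      exact ⟨fun i => ⟨fun hi => h2 ⟨i, hi⟩, fun hi => by_contra fun h => h3 ⟨i, h⟩ hi⟩, h1⟩
  have hI : ∀ I : Finset (Fin n), I.Nonempty →
      μ {S | (∀ i, i ∈ I ↔ S i ∈ A) ∧ (fun i : I => S i) ∈ T I} ≤ β * μ (pat I) := by
    intro I hne
    have hpatI : pat I = {S | (∀ i, i ∈ I ↔ S i ∈ A) ∧ (fun i : I => S i) ∈ Set.univ} := by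
      simp [hpat]
    rw [hpatI, hsplit, hsplit, ← mul_assoc]
    refine mul_le_mul_left ?_ _
    rw [Set.univ_inter]
    by_cases hA0 : D A = 0
    · have : Nonempty I := hne.to_subtype
      have h0 : Measure.pi (fun _ : I => D) (Set.univ.pi fun _ => A) = 0 := by
        rw [Measure.pi_pi, hA0, Finset.prod_const, Finset.card_univ,
          zero_pow Fintype.card_ne_zero]
      rw [measure_mono_null Set.inter_subset_right h0]
      exact zero_le
    · have h := hT hA0 I hne
      rw [pi_cond D hA0, Measure.smul_apply,
        Measure.restrict_apply' (MeasurableSet.univ_pi fun _ => hA), smul_eq_mul,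
        ← ENNReal.inv_pow, mul_comm, ← div_eq_mul_inv, ENNReal.div_le_iff
          (pow_ne_zero _ hA0) (ENNReal.pow_ne_top (measure_ne_top _ _))] at h
      rwa [Measure.pi_pi, Finset.prod_const, Finset.card_univ]
  have hpm : ∀ I, MeasurableSet (pat I) := fun I => by
    have : pat I = ⋂ i, {S | i ∈ I ↔ S i ∈ A} := by
      ext S
      simp [hpat]
    rw [this]
    refine MeasurableSet.iInter fun i => ?_
    have hm : MeasurableSet {S : Fin n → W | S i ∈ A} := measurable_pi_apply i hA
    by_cases hi : i ∈ I
    · simpa [hi] using hm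
    · have hcompl : {S : Fin n → W | i ∈ I ↔ S i ∈ A} = {S | S i ∈ A}ᶜ := by
        ext S
        simp [hi]
      rw [hcompl]
      exact hm.compl
  have hpd : ∑ I, μ (pat I) ≤ 1 := by
    refine (sum_measure_le_measure_univ (fun I _ => (hpm I).nullMeasurableSet) ?_).trans
      prob_le_one
    intro I _ J _ hIJ
    refine Disjoint.aedisjoint (Set.disjoint_left.2 fun S h1 h2 => hIJ ?_)
    ext i
    exact (h1 i).trans (h2 i).symm
  calc μ {S | ∃ I : Finset (Fin n), I.Nonempty ∧ (∀ i, i ∈ I ↔ S i ∈ A) ∧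
        (fun i : I => S i) ∈ T I}
      ≤ μ (⋃ I ∈ Finset.univ.filter fun I : Finset (Fin n) => I.Nonempty,
        {S | (∀ i, i ∈ I ↔ S i ∈ A) ∧ (fun i : I => S i) ∈ T I}) := by
        refine measure_mono fun S hS => ?_
        obtain ⟨I, h1, h2⟩ := hS
        simp only [Set.mem_iUnion]
        exact ⟨I, Finset.mem_filter.2 ⟨Finset.mem_univ _, h1⟩, h2⟩
    _ ≤ ∑ I with I.Nonempty, μ {S | (∀ i, i ∈ I ↔ S i ∈ A) ∧ (fun i : I => S i) ∈ T I} :=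
        measure_biUnion_finset_le _ _
    _ ≤ ∑ I with I.Nonempty, β * μ (pat I) :=
        Finset.sum_le_sum fun I h => hI I (Finset.mem_filter.1 h).2
    _ ≤ ∑ I, β * μ (pat I) := Finset.sum_le_sum_of_subset (Finset.filter_subset _ _)
    _ ≤ β := by
        rw [← Finset.mul_sum]
        exact mul_le_of_le_one_right' hpd

end Conditioning

/-! ### The accuracy of MGL-Tree -/

section Guarantee

variable {X Y Z : Type*} [MeasurableSpace X] [MeasurableSpace Y] {D : Measure (X × Y)}
  {ℓ : Z → Y → ℝ} {H : Set (X → Z)} {G : Finset (Set X)} {n : ℕ} {δ c : ℝ}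

theorem MeasurableClass.of_finite (hH : H.Finite)
    (hHmeas : ∀ h ∈ H, Measurable fun p : X × Y => ℓ (h p.1) p.2) : MeasurableClass ℓ D H := by
  intro m e
  have := hH.to_subtype
  refine (Measurable.iSup fun h : H => ?_).aemeasurable
  have hm := hHmeas h.1 h.2
  refine (Finset.measurable_sum _ fun i _ => ?_).abs
  exact (hm.comp (measurable_pi_apply i)).const_mul (e i)

variable [IsProbabilityMeasure D]

theorem MeasurableClass.aemeasurable_iSup_abs_sum_sub (hM : MeasurableClass ℓ D H) {ι : Type*}
    [Fintype ι] :
    AEMeasurable (fun s : ι ⊕ ι → X × Y => ⨆ h : H, |∑ i,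
      (ℓ (h.1 (s (Sum.inl i)).1) (s (Sum.inl i)).2 - ℓ (h.1 (s (Sum.inr i)).1) (s (Sum.inr i)).2)|)
      (Measure.pi fun _ => D) := by
  have e := (Fintype.equivFin (ι ⊕ ι)).symm
  have h1 := (hM _ fun i => Sum.elim (fun _ => 1) (fun _ => -1) (e i)).comp_quasiMeasurePreserving
    (measurePreserving_comp_equiv D e).quasiMeasurePreserving
  refine h1.congr (ae_of_all _ fun s => ?_)
  simp only [Function.comp_apply]
  refine iSup_congr fun h => ?_
  congr 1
  rw [e.sum_comp fun j => Sum.elim (fun _ => (1 : ℝ)) (fun _ => -1) j * ℓ (h.1 (s j).1) (s j).2,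
    Fintype.sum_sum_type, ← Finset.sum_add_distrib]
  refine Finset.sum_congr rfl fun i _ => ?_
  simp only [Sum.elim_inl, Sum.elim_inr]
  ring

/-- The empirical risks on one group deviate by more than half the error rate, for some member of
the class, with small probability. -/
theorem measure_empRisk_deviation_le (hℓ : ∀ z y, 0 ≤ ℓ z y ∧ ℓ z y ≤ 1) (hH : H.Nonempty)
    (hHmeas : ∀ h ∈ H, Measurable fun p : X × Y => ℓ (h p.1) p.2)
    (hM : MeasurableClass ℓ D H) {N : ℕ}
    (hcover : ∀ (I : Finset (Fin n)) (s : I ⊕ I → X × Y), ∃ V : Finset (I ⊕ I → ℝ), V.card ≤ N ∧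
      IsLinearCover (fun (h : H) j => ℓ (h.1 (s j).1) (s j).2) V)
    (hc : 1 ≤ c) {g : Set X} (hg : MeasurableSet g) :
    Measure.pi (fun _ : Fin n => D) {S | groupCount S g ≠ 0 ∧ ∃ h ∈ H,
      9 * √(c / (groupCount S g : ℝ)) < |empRisk ℓ S h g - risk ℓ D h g|} ≤
      ENNReal.ofReal (4 * N * Real.exp (-(10 * c))) := by
  classical
  have : Nonempty H := hH.to_subtype
  set A : Set (X × Y) := Prod.fst ⁻¹' g with hA
  set f : H → X × Y → ℝ := fun h p => ℓ (h.1 p.1) p.2 with hf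
  set T : ∀ I : Finset (Fin n), Set (I → X × Y) := fun I =>
    {s | ∃ h, 9 * √(c * I.card) < |∑ i, f h (s i) - I.card * ∫ p, f h p ∂(cond D A)|} with hT
  have hTle : D A ≠ 0 → ∀ I : Finset (Fin n), I.Nonempty →
      Measure.pi (fun _ : I => cond D A) (T I) ≤
        ENNReal.ofReal (4 * N * Real.exp (-(10 * c))) := by
    intro hA0 I hI
    have := cond_isProbabilityMeasure hA0
    have hk : (0 : ℝ) < I.card := by exact_mod_cast hI.card_pos
    have hsq : (9 * √(c * I.card)) ^ 2 = 81 * c * I.card := by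
      rw [mul_pow, Real.sq_sqrt (by positivity)]
      ring
    have h := measure_exists_lt_abs_sum_sub_integral_le (ι := I) f (fun h p => hℓ _ _)
      (fun h => hHmeas h.1 h.2) (cond D A) (hcover I)
      (hM.aemeasurable_iSup_abs_sum_sub.mono_ac (pi_cond_absolutelyContinuous D hA0))
      (r := 9 * √(c * I.card)) (by positivity) (by simpa using hI.card_pos)
      (by rw [hsq, Fintype.card_coe]; nlinarith)
    rw [Fintype.card_coe, hsq] at h
    -- The exponent is `r ^ 2 / (8 k) = 81 c / 8`, where `k` is the size of the subsample.
    refine h.trans (ENNReal.ofReal_le_ofReal ?_)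
    refine mul_le_mul_of_nonneg_left (Real.exp_le_exp.2 ?_) (by positivity)
    have : -(81 * c * (I.card : ℝ)) / (8 * I.card) = -(81 / 8 * c) := by
      field_simp
    rw [this]
    linarith
  refine le_trans (measure_mono ?_) (measure_subsample_le D (measurable_fst hg) T hTle)
  rintro S ⟨hn, h, hhH, hlt⟩
  set I : Finset (Fin n) := Finset.univ.filter fun i => (S i).1 ∈ g with hI
  have hcard : groupCount S g = I.card := by
    rw [groupCount, ← Set.ncard_coe_finset]
    congr 1
    ext i
    simp [hI]
  rw [hcard] at hn hlt
  have hk : (0 : ℝ) < I.card := by exact_mod_cast Nat.pos_of_ne_zero hn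
  refine ⟨I, Finset.card_ne_zero.1 hn, fun i => by simp [hI], ⟨h, hhH⟩, ?_⟩
  have hemp : empRisk ℓ S h g = 1 / (I.card : ℝ) * ∑ i : I, f ⟨h, hhH⟩ (S i) := by
    rw [empRisk, hcard, Finset.sum_coe_sort I fun i => f ⟨h, hhH⟩ (S i), hI, Finset.sum_filter]
    simp [Set.indicator_apply, hf]
  have hscale : ∑ i : I, f ⟨h, hhH⟩ (S i) - I.card * ∫ p, f ⟨h, hhH⟩ p ∂(cond D A) =
      I.card * (empRisk ℓ S h g - risk ℓ D h g) := by
    rw [hemp, risk]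
    change _ = I.card * (_ - ∫ p, f ⟨h, hhH⟩ p ∂(cond D A))
    field_simp
  have hsqrt : √(c * I.card) = I.card * √(c / I.card) := by
    rw [Real.sqrt_eq_iff_mul_self_eq (by positivity) (by positivity)]
    have := Real.mul_self_sqrt (show 0 ≤ c / (I.card : ℝ) by positivity)
    symm
    calc (I.card : ℝ) * √(c / I.card) * (I.card * √(c / I.card))
        = I.card * I.card * (√(c / I.card) * √(c / I.card)) := by ring
      _ = c * I.card := by
        rw [this]
        field_simp
  rw [hscale, abs_mul, abs_of_pos hk, hsqrt, mul_left_comm]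
  exact mul_lt_mul_of_pos_left hlt hk

/-- Without groups or without examples there is nothing to prove: all error rates are infinite. -/
theorem MGLTreeGuarantee.of_trivial (hδ0 : 0 < δ) (h : G = ∅ ∨ n = 0) :
    MGLTreeGuarantee ℓ D H G n δ c := by
  refine ⟨Set.univ, MeasurableSet.univ, ?_, fun S _ erm _ order _ g hg => ?_⟩
  · rw [measure_univ, ENNReal.ofReal_le_one]
    linarith
  · rcases h with rfl | rfl
    · exact (Finset.notMem_empty g hg).elim
    · have h0 : groupCount S g = 0 := by
        rw [groupCount, Set.eq_empty_of_isEmpty {i | (S i).1 ∈ g}, Set.ncard_empty]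
      rw [errRate, if_pos h0, EReal.mul_top_of_pos (by norm_num)]
      exact le_top

/-- The union bound over the groups. -/
theorem MGLTreeGuarantee.of_cover (hℓ : ∀ z y, 0 ≤ ℓ z y ∧ ℓ z y ≤ 1) (hH : H.Nonempty)
    (hHmeas : ∀ h ∈ H, Measurable fun p : X × Y => ℓ (h p.1) p.2)
    (hG : Hierarchical (G : Set (Set X))) (hGmeas : ∀ g ∈ G, MeasurableSet g)
    (hM : MeasurableClass ℓ D H) {N : ℕ}
    (hcover : ∀ (I : Finset (Fin n)) (s : I ⊕ I → X × Y), ∃ V : Finset (I ⊕ I → ℝ), V.card ≤ N ∧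
      IsLinearCover (fun (h : H) j => ℓ (h.1 (s j).1) (s j).2) V)
    (hc : 1 ≤ c) (hδ : G.card * (4 * N * Real.exp (-(10 * c))) ≤ δ) (hδ0 : 0 < δ) :
    MGLTreeGuarantee ℓ D H G n δ c := by
  set μ : Measure (Fin n → X × Y) := Measure.pi fun _ => D with hμ
  set B : Set X → Set (Fin n → X × Y) := fun g => {S | groupCount S g ≠ 0 ∧ ∃ h ∈ H,
      9 * √(c / (groupCount S g : ℝ)) < |empRisk ℓ S h g - risk ℓ D h g|} with hB
  have hbad : μ (⋃ g ∈ G, B g) ≤ ENNReal.ofReal δ := by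
    calc μ (⋃ g ∈ G, B g) ≤ ∑ g ∈ G, μ (B g) := measure_biUnion_finset_le _ _
      _ ≤ ∑ _g ∈ G, ENNReal.ofReal (4 * N * Real.exp (-(10 * c))) :=
        Finset.sum_le_sum fun g hg =>
          measure_empRisk_deviation_le hℓ hH hHmeas hM hcover hc (hGmeas g hg)
      _ = ENNReal.ofReal (G.card * (4 * N * Real.exp (-(10 * c)))) := by
        rw [Finset.sum_const, nsmul_eq_mul, ENNReal.ofReal_mul (p := (G.card : ℝ)) (by positivity),
          ENNReal.ofReal_natCast]
      _ ≤ ENNReal.ofReal δ := ENNReal.ofReal_le_ofReal hδ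
  -- The bad event need not be measurable, so that a measurable superset is removed instead.
  refine ⟨(toMeasurable μ (⋃ g ∈ G, B g))ᶜ, (measurableSet_toMeasurable _ _).compl, ?_, ?_⟩
  · rw [prob_compl_eq_one_sub (measurableSet_toMeasurable _ _), measure_toMeasurable,
      ENNReal.ofReal_sub _ hδ0.le, ENNReal.ofReal_one]
    exact tsub_le_tsub_left hbad 1
  · intro S hS erm herm order ho g hg
    refine risk_mglTree_le hℓ hH hHmeas hG hGmeas (fun q hq hn h hh => ?_) herm ho hg
    by_contra hlt
    exact hS (subset_toMeasurable _ _ (Set.mem_biUnion hq ⟨hn, h, hh, not_le.1 hlt⟩))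

end Guarantee

end MGL

theorem theorem2 {X Y Z : Type*} [MeasurableSpace X] [MeasurableSpace Y]
    (D : Measure (X × Y)) [IsProbabilityMeasure D]
    (ℓ : Z → Y → ℝ) (hℓ : ∀ z y, 0 ≤ ℓ z y ∧ ℓ z y ≤ 1)
    (H : Set (X → Z)) (hH : H.Nonempty)
    (hHmeas : ∀ h ∈ H, Measurable (fun p : X × Y => ℓ (h p.1) p.2))
    (G : Finset (Set X)) (hG : MGL.Hierarchical (G : Set (Set X)))
    (hGmeas : ∀ g ∈ G, MeasurableSet g)
    (n : ℕ) (δ : ℝ) (hδ0 : 0 < δ) (hδ1 : δ < 1) :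
    (H.Finite →
      MGL.MGLTreeGuarantee ℓ D H G n δ
        (2 * Real.log ((G.card : ℝ) * (H.ncard : ℝ)) + Real.log (8 / δ))) ∧
    (∀ d : ℕ, 1 ≤ d → MGL.VCDimLE ℓ H d → MGL.MeasurableClass ℓ D H →
      MGL.MGLTreeGuarantee ℓ D H G n δ
        (2 * (d : ℝ) * Real.log (16 * (G.card : ℝ) * (n : ℝ) / δ))) := by
  by_cases htriv : G = ∅ ∨ n = 0
  · exact ⟨fun _ => .of_trivial hδ0 htriv, fun _ _ _ _ => .of_trivial hδ0 htriv⟩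
  obtain ⟨hG0, hn0⟩ := not_or.1 htriv
  have hGc : (1 : ℝ) ≤ G.card := by
    exact_mod_cast Finset.card_pos.2 (Finset.nonempty_iff_ne_empty.2 hG0)
  have hn : (1 : ℝ) ≤ n := by exact_mod_cast Nat.pos_of_ne_zero hn0
  have hlog8 : 1 ≤ Real.log 8 := by
    rw [Real.le_log_iff_exp_le (by norm_num)]
    linarith [Real.exp_one_lt_d9]
  constructor
  · intro hfin
    have hHc : (1 : ℝ) ≤ H.ncard := by
      exact_mod_cast (Set.ncard_pos hfin).2 hH
    set M : ℝ := G.card * H.ncard with hM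
    have hM1 : 1 ≤ M := one_le_mul_of_one_le_of_one_le hGc hHc
    set c : ℝ := 2 * Real.log M + Real.log (8 / δ) with hc
    have hc1 : 1 ≤ c := by
      have h1 : Real.log 8 ≤ Real.log (8 / δ) :=
        Real.log_le_log (by norm_num) (by rw [le_div_iff₀ hδ0]; linarith)
      have h2 := Real.log_nonneg hM1
      linarith
    have hexp : Real.exp (-c) = δ / (8 * M ^ 2) := by
      have : -c = Real.log (δ / (8 * M ^ 2)) := by
        rw [hc, Real.log_div (by positivity) (by positivity), Real.log_div (by positivity)
          (by positivity), Real.log_mul (x := 8) (by positivity) (by positivity), Real.log_pow]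
        push_cast
        ring
      rw [this, Real.exp_log (by positivity)]
    refine .of_cover hℓ hH hHmeas hG hGmeas (.of_finite hfin hHmeas)
      (fun I s => MGL.exists_isLinearCover_of_finite hℓ hfin s) hc1 ?_ hδ0
    calc (G.card : ℝ) * (4 * H.ncard * Real.exp (-(10 * c)))
        = 4 * M * Real.exp (-(10 * c)) := by
          rw [hM]
          ring
      _ ≤ 4 * M * Real.exp (-c) := by
          refine mul_le_mul_of_nonneg_left (Real.exp_le_exp.2 ?_) (by positivity)
          linarith
      _ = δ / (2 * M) := by
          rw [hexp]
          field_simp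
          norm_num
      _ ≤ δ := div_le_self hδ0.le (by linarith)
  · intro d hd hvc hmc
    set x : ℝ := 16 * G.card * n / δ with hx
    have hx16 : 16 * (G.card * n) ≤ x := by
      rw [hx, le_div_iff₀ hδ0, mul_assoc]
      have : 0 ≤ 16 * ((G.card : ℝ) * n) := by positivity
      nlinarith
    have hGn : (n : ℝ) ≤ G.card * n := le_mul_of_one_le_left (by positivity) hGc
    have hx0 : 0 < x := by linarith
    have hd' : (1 : ℝ) ≤ d := by exact_mod_cast hd
    have hlogx : 1 ≤ Real.log x :=
      hlog8.trans (Real.log_le_log (by norm_num) (by linarith))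
    set c : ℝ := 2 * d * Real.log x with hc
    have hc1 : 1 ≤ c := by nlinarith
    have hexp : Real.exp (-c) = ((x ^ d) ^ 2)⁻¹ := by
      rw [Real.exp_neg, hc, mul_assoc, ← Real.log_pow, two_mul, Real.exp_add,
        Real.exp_log (by positivity), sq]
    -- A double sample has at most `2 n` points; one of the two factors `x ^ (-d)` of `exp (-c)`
    -- absorbs the growth bound `(2 n + 1) ^ d ≤ x ^ d`.
    refine .of_cover (N := (2 * n + 1) ^ d) hℓ hH hHmeas hG hGmeas hmc (fun I s => ?_) hc1 ?_ hδ0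
    · obtain ⟨V, hV, hVc⟩ := MGL.exists_isLinearCover_of_vcDimLE hℓ hvc s
      refine ⟨V, hV.trans (Nat.pow_le_pow_left ?_ d), hVc⟩
      have : I.card ≤ n := by simpa using I.card_le_univ
      rw [Fintype.card_sum, Fintype.card_coe]
      omega
    · have hN : (((2 * n + 1) ^ d : ℕ) : ℝ) ≤ x ^ d := by
        push_cast
        exact pow_le_pow_left₀ (by positivity) (by linarith) d
      have hxd : x ≤ x ^ d := le_self_pow₀ (by linarith) (by omega)
      calc (G.card : ℝ) * (4 * ((2 * n + 1) ^ d : ℕ) * Real.exp (-(10 * c)))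
          ≤ G.card * (4 * x ^ d * Real.exp (-c)) := by
            gcongr
            linarith
        _ = 4 * G.card / x ^ d := by
            rw [hexp]
            field_simp
        _ ≤ 4 * G.card / x := div_le_div_of_nonneg_left (by positivity) hx0 hxd
        _ = δ / (4 * n) := by
            rw [hx]
            field_simp
            norm_num
        _ ≤ δ := div_le_self hδ0.le (by linarith)
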